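/- Let $U$ be a compact connected Lie group, $\theta$ a smooth involutive automorphism of $U$ (that is, $\theta^2=\mathrm{id}$), and $K$ a closed subgroup with $(U^\theta)_0\subseteq K\subseteq U^\theta$, where $U^\theta$ is the group of fixed points of $\theta$ and $(U^\theta)_0$ its identity component, so that $U/K$ is a compact symmetric space. Let $m_K$ be the normalized Haar measure of $K$. For $a\in U$ let $\mu_a$ be the probability measure on $U$ with $$\int_U f\,\mathrm{d}\mu_a=\int_K\int_K f(k_1ak_2)\,\mathrm{d}m_K(k_1)\,\mathrm{d}m_K(k_2)\qquad(f\in C(U)),$$ and for an integer $p\ge 2$ let $\mu_a^{(p)}$ be the convolution of $p$ copies of $\mu_a$. Let $\widehat U$ be the set of equivalence classes of (continuous, finite-dimensional) irreducible unitary representations of $U$, and fix a representative $(\pi,E_\pi)$ of each class. For a finite measure $\mu$ on $U$ put $$\widehat\mu(\pi)X=\int_U\pi(g^{-1})X\,\mathrm{d}\mu(g)\quad(X\in E_\pi),\qquad \|\widehat\mu\|_2^2=\sum_{[\pi]\in\widehat U}(\dim E_\pi)\,\|\widehat\mu(\pi)\|_{\mathrm{HS}}^2\in[0,\infty],$$ where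 $\|\cdot\|_{\mathrm{HS}}$ is the Hilbert--Schmidt norm. Call $\pi$ spherical if the space $E_\pi^K$ of $K$-fixed vectors in $E_\pi$ is one-dimensional, and in that case let $X_\pi\in E_\pi^K$ be any vector with $\|X_\pi\|=1$. Then, for all $a\in U$ and all integers $p\ge2$, $$\big\|\widehat{\mu_a^{(p)}}\big\|_2^2=\sum_{\substack{[\pi]\in\widehat U\\ \pi\ \text{spherical}}}(\dim E_\pi)\,\big|(\pi(a)X_\pi,X_\pi)\big|^{2p}$$ as an equality in $[0,\infty]$ (both sides may be infinite). -/

import Mathlib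

open MeasureTheory Module
open scoped Manifold ContDiff ENNReal

/-- `(U, K)` is a symmetric pair with respect to `θ`: `θ` is a smooth involutive automorphism of
the Lie group `U`, and `K` is a closed subgroup lying between the identity component of the
fixed-point group of `θ` and the fixed-point group itself.  If `U` is moreover compact and
connected, `U / K` is a compact symmetric space. -/
structure IsSymmetricPair {V : Type*} [NormedAddCommGroup V] [NormedSpace ℝ V]
    {U : Type*} [Group U] [TopologicalSpace U] [ChartedSpace V U]
    (θ : U →* U) (K : Subgroup U) : Prop where
  contMDiff : ContMDiff 𝓘(ℝ, V) 𝓘(ℝ, V) ∞ θ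
  involutive : Function.Involutive θ
  isClosed : IsClosed (K : Set U)
  identityComponent_subset : connectedComponentIn {g : U | θ g = g} 1 ⊆ (K : Set U)
  subset_fixedPoints : (K : Set U) ⊆ {g : U | θ g = g}

/-- A continuous irreducible unitary representation of `U` on a finite-dimensional complex inner
product space. -/
structure UnitaryIrrep (U : Type*) [Group U] [TopologicalSpace U] where
  /-- The space of the representation. -/
  E : Type
  [normedAddCommGroup : NormedAddCommGroup E]
  [innerProductSpace : InnerProductSpace ℂ E]
  [finiteDimensional : FiniteDimensional ℂ E]
  /-- The action of the group. -/
  ρ : Representation ℂ U E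
  continuous_apply : ∀ v : E, Continuous fun g : U => ρ g v
  inner_map_map : ∀ (g : U) (v w : E), inner ℂ (ρ g v) (ρ g w) = inner ℂ v w
  irreducible : ρ.IsIrreducible

namespace UnitaryIrrep

attribute [instance] normedAddCommGroup innerProductSpace finiteDimensional

section

variable {U : Type*} [Group U] [TopologicalSpace U]

/-- Unitary equivalence of irreducible unitary representations. -/
instance setoid (U : Type*) [Group U] [TopologicalSpace U] : Setoid (UnitaryIrrep U) where
  r π σ := ∃ T : π.E ≃ₗᵢ[ℂ] σ.E, ∀ (g : U) (v : π.E), T (π.ρ g v) = σ.ρ g (T v)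
  iseqv :=
    { refl := fun π => ⟨LinearIsometryEquiv.refl ℂ π.E, fun _ _ => rfl⟩
      symm := by
        rintro π σ ⟨T, hT⟩
        refine ⟨T.symm, fun g v => ?_⟩
        apply T.injective
        simp [hT]
      trans := by
        rintro π σ τ ⟨S, hS⟩ ⟨T, hT⟩
        exact ⟨S.trans T, fun g v => by simp [hS, hT]⟩ }

/-- The space `E_π^K` of `K`-fixed vectors. -/
noncomputable def fixedVectors (π : UnitaryIrrep U) (K : Subgroup U) : Submodule ℂ π.E :=
  Representation.invariants (π.ρ.comp K.subtype)

/-- `π` is spherical (of class one) if its space of `K`-fixed vectors is one-dimensional. -/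
def IsSpherical (π : UnitaryIrrep U) (K : Subgroup U) : Prop :=
  finrank ℂ (π.fixedVectors K) = 1

/-- The squared Hilbert--Schmidt norm of an endomorphism of `E_π`. -/
noncomputable def hsNormSq (π : UnitaryIrrep U) (T : π.E →ₗ[ℂ] π.E) : ℝ :=
  ∑ i, ‖T (stdOrthonormalBasis ℂ π.E i)‖ ^ 2

variable [IsTopologicalGroup U] [CompactSpace U] [MeasurableSpace U] [BorelSpace U]

theorem integrable_apply_inv (π : UnitaryIrrep U) (μ : Measure U) [IsFiniteMeasure μ]
    (v : π.E) : Integrable (fun g : U => π.ρ g⁻¹ v) μ := by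
  have hc : Continuous fun g : U => π.ρ g⁻¹ v := (π.continuous_apply v).comp continuous_inv
  have : ProperSpace π.E := FiniteDimensional.proper ℂ π.E
  exact hc.integrable_of_hasCompactSupport (HasCompactSupport.of_compactSpace _)

/-- The Fourier transform `X ↦ ∫ π(g⁻¹) X dμ(g)` of a finite measure at `π`. -/
noncomputable def fourier (π : UnitaryIrrep U) (μ : Measure U) [IsFiniteMeasure μ] :
    π.E →ₗ[ℂ] π.E where
  toFun v := ∫ g, π.ρ g⁻¹ v ∂μ
  map_add' v w := by
    simp only [map_add]
    exact integral_add (π.integrable_apply_inv μ v) (π.integrable_apply_inv μ w)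
  map_smul' c v := by
    simp only [map_smul, RingHom.id_apply]
    exact integral_smul c _

end

end UnitaryIrrep

/-- The unitary dual: equivalence classes of irreducible unitary representations. -/
abbrev UnitaryDual (U : Type*) [Group U] [TopologicalSpace U] : Type _ :=
  Quotient (UnitaryIrrep.setoid U)

section Measures

variable {U : Type*} [Group U] [MeasurableSpace U]

/-- The orbital measure on `K a K`: the image of `m_K × m_K` under `(k₁, k₂) ↦ k₁ a k₂`. -/
noncomputable def orbitalMeasure {K : Subgroup U} (mK : Measure K) (a : U) : Measure U :=
  Measure.map (fun k : K × K => (k.1 : U) * a * (k.2 : U)) (mK.prod mK)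

instance {K : Subgroup U} (mK : Measure K) [IsFiniteMeasure mK] (a : U) :
    IsFiniteMeasure (orbitalMeasure mK a) := by
  unfold orbitalMeasure
  infer_instance

/-- The `p`-fold convolution power of a measure. -/
noncomputable def convPow (μ : Measure U) : ℕ → Measure U
  | 0 => Measure.dirac 1
  | p + 1 => Measure.mconv (convPow μ p) μ

instance (μ : Measure U) [IsFiniteMeasure μ] (p : ℕ) : IsFiniteMeasure (convPow μ p) := by
  induction p with
  | zero => unfold convPow; infer_instance
  | succ p ih => unfold convPow Measure.mconv; infer_instance

end Measures

/-- The squared Plancherel norm `∑_{[π]} (dim E_π) ‖μ̂(π)‖²_HS ∈ [0, ∞]` of the Fourier transform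
of `μ`, computed with a representative `r c` of each class `c` of the unitary dual. -/
noncomputable def plancherelNormSq {U : Type*} [Group U] [TopologicalSpace U]
    [IsTopologicalGroup U] [CompactSpace U] [MeasurableSpace U] [BorelSpace U]
    (r : UnitaryDual U → UnitaryIrrep U) (μ : Measure U) [IsFiniteMeasure μ] : ℝ≥0∞ :=
  ∑' c : UnitaryDual U,
    (finrank ℂ (r c).E : ℝ≥0∞) * ENNReal.ofReal ((r c).hsNormSq ((r c).fourier μ))

/-! Let `P` be the orthogonal projection of `E_π` onto `E_π^K`. Averaging over `K` gives `μ̂_a(π) =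
P π(a⁻¹) P`, and convolution becomes composition, so the transform of the `p`-th power is `(P π(a⁻¹)
P)^p`. It vanishes if `E_π^K = 0`. If `E_π^K = ℂX` with `‖X‖ = 1`, it is the rank-one operator `c^p
⟨X, ·⟩ X` with `c = ⟨X, π(a⁻¹) X⟩`, whose squared Hilbert–Schmidt norm is `|c|^(2p)`.

It remains to see that `dim E_π^K ≤ 1` (`finrank_fixedVectors_le_one`). By Gelfand's trick the
operators `P π(g) P` commute once coefficients of `K`-fixed vectors are invariant under the
anti-automorphism `g ↦ θ(g)⁻¹`; irreducibility then makes `E_π^K` at most a line. For `g = ks` with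
`k ∈ K` and `θ(s) = s⁻¹`, the invariance is immediate, since `θ(g)⁻¹ = sk⁻¹`. This factorization is
proved only near the identity (`eventually_exists_eq_mul_of_involutive`). Connectedness of `U` and
finite-dimensionality of `E_π` spread the invariance to all of `U`
(`MonoidHom.apply_mem_span_image_of_mem_nhds_one`). -/

open Filter Topology

/-! ### Local structure of a Lie group with an involution. -/

section LieGroupLocal

variable {V : Type*} [NormedAddCommGroup V] [NormedSpace ℝ V]
  {U : Type*} [Group U] [TopologicalSpace U] [ChartedSpace V U]

/-- In the chart at the identity, multiplication of a Lie group has derivative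
`(u, v) ↦ u + v`. -/
theorem hasStrictFDerivAt_chart_mul [LieGroup 𝓘(ℝ, V) ∞ U] :
    HasStrictFDerivAt
      (fun y : V × V => chartAt V (1 : U) ((chartAt V (1 : U)).symm y.1 *
        (chartAt V (1 : U)).symm y.2))
      (ContinuousLinearMap.fst ℝ V V + ContinuousLinearMap.snd ℝ V V)
      (chartAt V (1 : U) 1, chartAt V (1 : U) 1) := by
  have : IsManifold 𝓘(ℝ, V) ∞ U := LieGroup.toContMDiffMul.toIsManifold
  set e := chartAt V (1 : U)
  have h1 : (1 : U) ∈ e.source := mem_chart_source V 1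
  have hy : e 1 ∈ e.target := e.map_source h1
  have hes : ContMDiffAt 𝓘(ℝ, V) 𝓘(ℝ, V) ∞ e.symm (e 1) :=
    (contMDiffOn_chart_symm (x := (1 : U))).contMDiffAt (e.open_target.mem_nhds hy)
  have hm : ContMDiffAt 𝓘(ℝ, V × V) 𝓘(ℝ, V) ∞
      (fun y : V × V => e.symm y.1 * e.symm y.2) (e 1, e 1) := by
    refine ContMDiffAt.mul ?_ ?_
    · exact ContMDiffAt.comp (g := e.symm) (f := Prod.fst) (e 1, e 1) hes
        contDiffAt_fst.contMDiffAt
    · exact ContMDiffAt.comp (g := e.symm) (f := Prod.snd) (e 1, e 1) hes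
        contDiffAt_snd.contMDiffAt
  have heat : ContMDiffAt 𝓘(ℝ, V) 𝓘(ℝ, V) ∞ e
      ((fun y : V × V => e.symm y.1 * e.symm y.2) (e 1, e 1)) := by
    refine (contMDiffOn_chart (x := (1 : U))).contMDiffAt (e.open_source.mem_nhds ?_)
    simpa [e.left_inv h1] using h1
  have hc : ContDiffAt ℝ ∞ (fun y : V × V => e (e.symm y.1 * e.symm y.2)) (e 1, e 1) :=
    (ContMDiffAt.comp (e 1, e 1) heat hm).contDiffAt
  have hd := hc.hasStrictFDerivAt (by simp)
  refine hd.congr_fderiv ?_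
  set D := fderiv ℝ (fun y : V × V => e (e.symm y.1 * e.symm y.2)) (e 1, e 1)
  -- `D` is determined by its restrictions to the two factors; each is the identity because `g * 1 =
  -- g = 1 * g`.
  have hl : HasFDerivAt (fun y : V => e (e.symm y * e.symm (e 1)))
      (D.comp (ContinuousLinearMap.inl ℝ V V)) (e 1) :=
    hd.hasFDerivAt.comp (f := fun y : V => (y, e 1)) (e 1) (hasFDerivAt_prodMk_left (e 1) (e 1))
  have hr : HasFDerivAt (fun y : V => e (e.symm (e 1) * e.symm y))
      (D.comp (ContinuousLinearMap.inr ℝ V V)) (e 1) :=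
    hd.hasFDerivAt.comp (f := fun y : V => (e 1, y)) (e 1) (hasFDerivAt_prodMk_right (e 1) (e 1))
  have hid : ∀ᶠ y in 𝓝 (e 1), e (e.symm y) = y := by
    filter_upwards [e.open_target.mem_nhds hy] with y hy using e.right_inv hy
  have hl' : D.comp (ContinuousLinearMap.inl ℝ V V) = ContinuousLinearMap.id ℝ V := by
    refine hl.unique ((hasFDerivAt_id (e 1)).congr_of_eventuallyEq ?_)
    filter_upwards [hid] with y hy
    simp [e.left_inv h1, hy]
  have hr' : D.comp (ContinuousLinearMap.inr ℝ V V) = ContinuousLinearMap.id ℝ V := by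
    refine hr.unique ((hasFDerivAt_id (e 1)).congr_of_eventuallyEq ?_)
    filter_upwards [hid] with y hy
    simp [e.left_inv h1, hy]
  refine ContinuousLinearMap.ext fun (v : V × V) => ?_
  have h₁ := DFunLike.congr_fun hl' v.1
  have h₂ := DFunLike.congr_fun hr' v.2
  simp only [ContinuousLinearMap.comp_apply, ContinuousLinearMap.inl_apply,
    ContinuousLinearMap.inr_apply, ContinuousLinearMap.id_apply] at h₁ h₂
  have : D v = D (v.1, 0) + D (0, v.2) := by rw [← map_add]; simp
  rw [this, h₁, h₂]
  rfl

/-- In a Lie group, squaring is a local homeomorphism at the identity. -/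
theorem exists_injOn_sq_and_map_sq_nhds_one [FiniteDimensional ℝ V] [LieGroup 𝓘(ℝ, V) ∞ U] :
    (∃ W ∈ 𝓝 (1 : U), Set.InjOn (fun g : U => g * g) W) ∧
      map (fun g : U => g * g) (𝓝 1) = 𝓝 1 := by
  have : CompleteSpace V := FiniteDimensional.complete ℝ V
  have : IsTopologicalGroup U := topologicalGroup_of_lieGroup 𝓘(ℝ, V) ∞
  set e := chartAt V (1 : U)
  have h1 : (1 : U) ∈ e.source := mem_chart_source V 1
  have hy : e 1 ∈ e.target := e.map_source h1
  -- Multiplication composed with the diagonal has derivative `v ↦ 2v`, which is invertible, so the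
  -- inverse function theorem applies.
  have hS : HasStrictFDerivAt (fun y : V => e (e.symm y * e.symm y))
      ((ContinuousLinearEquiv.smulLeft (Units.mk0 (2 : ℝ) two_ne_zero) : V ≃L[ℝ] V) : V →L[ℝ] V)
      (e 1) := by
    have := (hasStrictFDerivAt_chart_mul (V := V) (U := U)).comp (f := fun y : V => (y, y)) (e 1)
      ((hasStrictFDerivAt_id (𝕜 := ℝ) (e 1)).prodMk (hasStrictFDerivAt_id (e 1)))
    convert this using 1
    ext v
    simp [two_smul, Units.smul_def]
  have hS1 : e (e.symm (e 1) * e.symm (e 1)) = e 1 := by simp [e.left_inv h1]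
  have hsrc : ∀ᶠ g in 𝓝 (1 : U), e g ∈ (hS.toOpenPartialHomeomorph _).source :=
    (e.continuousAt h1).eventually
      ((hS.toOpenPartialHomeomorph _).open_source.mem_nhds hS.mem_toOpenPartialHomeomorph_source)
  have hes : ∀ᶠ g in 𝓝 (1 : U), g ∈ e.source := e.open_source.mem_nhds h1
  constructor
  · refine ⟨_, hsrc.and hes, fun x hx y hy' hxy => ?_⟩
    apply e.injOn hx.2 hy'.2
    apply (hS.toOpenPartialHomeomorph _).injOn hx.1 hy'.1
    simp only [HasStrictFDerivAt.toOpenPartialHomeomorph_coe]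
    rw [e.left_inv hx.2, e.left_inv hy'.2]
    exact congrArg e hxy
  · have h2 := hS.map_nhds_eq_of_equiv
    simp only [hS1] at h2
    have h3 : map e (𝓝 1) = 𝓝 (e 1) := e.map_nhds_eq h1
    have h4 : map e.symm (𝓝 (e 1)) = 𝓝 1 := by
      have := e.symm.map_nhds_eq (x := e 1) hy
      rwa [e.left_inv h1] at this
    have hsq : ∀ᶠ g in 𝓝 (1 : U), g * g ∈ e.source := by
      have : ContinuousAt (fun g : U => g * g) 1 := by fun_prop
      refine this.eventually (e.open_source.mem_nhds ?_)
      simpa using h1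
    have h5 : map (fun g : U => g * g) (𝓝 1)
        = map (fun g : U => e.symm (e (e.symm (e g) * e.symm (e g)))) (𝓝 1) := by
      apply Filter.map_congr
      filter_upwards [hes, hsq] with g hg hg2
      simp only [e.left_inv hg, e.left_inv hg2]
    rw [h5]
    conv_rhs => rw [← h4, ← h2, ← h3]
    simp only [map_map]
    rfl

/-- The fixed points of an involutive automorphism of a Lie group that are close to the identity
lie in the identity component of the fixed-point set. The map `Ψ` in the proof is a chart in which
the involution is linear. -/
theorem eventually_mem_connectedComponentIn_fixedPoints [FiniteDimensional ℝ V]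
    [LieGroup 𝓘(ℝ, V) ∞ U] {θ : U →* U} (hθ : ContMDiff 𝓘(ℝ, V) 𝓘(ℝ, V) ∞ θ)
    (hinv : Function.Involutive θ) :
    ∀ᶠ k in 𝓝 (1 : U), θ k = k → k ∈ connectedComponentIn {g : U | θ g = g} 1 := by
  have : CompleteSpace V := FiniteDimensional.complete ℝ V
  have : IsManifold 𝓘(ℝ, V) ∞ U := LieGroup.toContMDiffMul.toIsManifold
  set e := chartAt V (1 : U)
  have h1 : (1 : U) ∈ e.source := mem_chart_source V 1
  have hy : e 1 ∈ e.target := e.map_source h1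
  have hes : ContMDiffAt 𝓘(ℝ, V) 𝓘(ℝ, V) ∞ e.symm (e 1) :=
    (contMDiffOn_chart_symm (x := (1 : U))).contMDiffAt (e.open_target.mem_nhds hy)
  have heat : ContMDiffAt 𝓘(ℝ, V) 𝓘(ℝ, V) ∞ e ((θ ∘ e.symm) (e 1)) := by
    refine (contMDiffOn_chart (x := (1 : U))).contMDiffAt (e.open_source.mem_nhds ?_)
    simpa [e.left_inv h1] using h1
  have hc : ContDiffAt ℝ ∞ (fun y : V => e (θ (e.symm y))) (e 1) :=
    (ContMDiffAt.comp (e 1) heat (hθ.contMDiffAt.comp (e 1) hes)).contDiffAt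
  set Θ : V → V := fun y => e (θ (e.symm y)) with hΘ
  have hΘ1 : Θ (e 1) = e 1 := by simp [hΘ, e.left_inv h1]
  have hd := hc.hasStrictFDerivAt (by simp)
  set L : V →L[ℝ] V := fderiv ℝ Θ (e 1)
  have hts : ∀ᶠ y in 𝓝 (e 1), y ∈ e.target := e.open_target.mem_nhds hy
  have hθs : ∀ᶠ y in 𝓝 (e 1), θ (e.symm y) ∈ e.source := by
    have : ContinuousAt (fun y => θ (e.symm y)) (e 1) :=
      ContinuousAt.comp (g := θ) hθ.continuous.continuousAt (e.continuousAt_symm hy)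
    refine this.eventually (e.open_source.mem_nhds ?_)
    simpa [e.left_inv h1] using h1
  have hΘΘ : ∀ᶠ y in 𝓝 (e 1), Θ (Θ y) = y := by
    filter_upwards [hts, hθs] with y hy1 hy2
    simp only [hΘ, e.left_inv hy2, hinv (e.symm y), e.right_inv hy1]
  have hLL : ∀ v, L (L v) = v := by
    have h : HasFDerivAt (fun y => Θ (Θ y)) (L.comp L) (e 1) := by
      refine HasFDerivAt.comp (e 1) (g := Θ) ?_ hd.hasFDerivAt
      rw [hΘ1]; exact hd.hasFDerivAt
    have h' := h.unique ((hasFDerivAt_id (e 1)).congr_of_eventuallyEq hΘΘ)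
    exact fun v => DFunLike.congr_fun h' v
  -- Bochner's linearization: average the centred coordinate over the two-element group generated by
  -- `θ`. Since `L² = 1`, this gives derivative `1` and `Ψ ∘ Θ = L ∘ Ψ`.
  set Ψ : V → V := fun y => (2 : ℝ)⁻¹ • ((y - e 1) + L (Θ y - e 1)) with hΨ
  have hΨd : HasStrictFDerivAt Ψ ((ContinuousLinearEquiv.refl ℝ V : V ≃L[ℝ] V) : V →L[ℝ] V)
      (e 1) := by
    have := (((hasStrictFDerivAt_id (𝕜 := ℝ) (e 1)).sub_const (e 1)).add
      (L.hasStrictFDerivAt.comp (e 1) (hd.sub_const (e 1)))).const_smul (2 : ℝ)⁻¹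
    refine this.congr_fderiv ?_
    ext v
    simp [hLL, ← add_smul]
    norm_num
  have hΨ1 : Ψ (e 1) = 0 := by simp [hΨ, hΘ1]
  have hΨΘ : ∀ᶠ y in 𝓝 (e 1), Ψ (Θ y) = L (Ψ y) := by
    filter_upwards [hΘΘ] with y hy
    simp only [hΨ, hy, map_smul, map_add, hLL]
    rw [add_comm]
  set h := hΨd.toOpenPartialHomeomorph Ψ
  have hhcoe : ∀ y, h y = Ψ y := fun _ => rfl
  have hs1 : e 1 ∈ h.source := hΨd.mem_toOpenPartialHomeomorph_source
  have hsrc : ∀ᶠ y in 𝓝 (e 1), y ∈ h.source := h.open_source.mem_nhds hs1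
  have hΘsrc : ∀ᶠ y in 𝓝 (e 1), Θ y ∈ h.source := by
    refine hc.continuousAt.eventually ?_
    rw [hΘ1]; exact hsrc
  have hgood := hts.and (hθs.and (hΨΘ.and hΘsrc))
  have h0t : (0 : V) ∈ h.target := by
    rw [← hΨ1]; exact h.map_source hs1
  have hsymm0 : h.symm 0 = e 1 := by
    rw [← hΨ1]; exact h.left_inv hs1
  have htgt : ∀ᶠ z in 𝓝 (0 : V), z ∈ h.target := h.open_target.mem_nhds h0t
  have hgood' := htgt.and
      ((h.continuousAt_symm h0t).eventually (by rw [hsymm0]; exact hgood))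
  obtain ⟨ε, hε, hB⟩ := Metric.eventually_nhds_iff_ball.1 hgood'
  -- In the chart `Ψ` the fixed points near the identity form a convex set, whose image joins each
  -- of them to `1`.
  let C : Set V := Metric.ball 0 ε ∩ {z | L z = z}
  have hC : IsPreconnected C := by
    refine ((convex_ball 0 ε).inter ?_).isPreconnected
    intro x hx y hy a b _ _ _
    simp only [Set.mem_ofPred_eq] at hx hy ⊢
    simp [hx, hy]
  have hcont : ContinuousOn (fun z => e.symm (h.symm z)) C := by
    intro z hz
    have hz' := hB z hz.1
    exact (ContinuousAt.comp (g := e.symm) (e.continuousAt_symm hz'.2.1)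
      (h.continuousAt_symm hz'.1)).continuousWithinAt
  have himg : (fun z => e.symm (h.symm z)) '' C ⊆ {g : U | θ g = g} := by
    rintro _ ⟨z, hz, rfl⟩
    obtain ⟨hzt, hz1, hz2, hz3, hz4⟩ := hB z hz.1
    have hfix : Θ (h.symm z) = h.symm z := by
      apply h.injOn hz4 (h.map_target hzt)
      rw [hhcoe, hz3, ← hhcoe, h.right_inv hzt]
      exact hz.2
    change θ (e.symm (h.symm z)) = e.symm (h.symm z)
    rw [← e.left_inv hz2]
    exact congrArg e.symm hfix
  have h1mem : (1 : U) ∈ (fun z => e.symm (h.symm z)) '' C := by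
    refine ⟨0, ⟨Metric.mem_ball_self hε, by simp⟩, ?_⟩
    simp [hsymm0, e.left_inv h1]
  have hsub := (hC.image _ hcont).subset_connectedComponentIn h1mem himg
  have hball : ∀ᶠ y in 𝓝 (e 1), Ψ y ∈ Metric.ball (0 : V) ε := by
    refine hΨd.continuousAt.eventually ?_
    rw [hΨ1]; exact Metric.ball_mem_nhds _ hε
  filter_upwards [(e.continuousAt h1).eventually (hsrc.and (hball.and hΨΘ)),
    e.open_source.mem_nhds h1] with k hk hks hθk
  obtain ⟨hk1, hk2, hk3⟩ := hk
  refine hsub ⟨Ψ (e k), ⟨hk2, ?_⟩, ?_⟩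
  · change L (Ψ (e k)) = Ψ (e k)
    rw [← hk3]
    simp [hΘ, e.left_inv hks, hθk]
  · change e.symm (h.symm (h (e k))) = k
    rw [h.left_inv hk1, e.left_inv hks]

/-- Local Cartan decomposition: near the identity, every element is the product of an element of
the identity component of the fixed-point group and an element inverted by the involution. -/
theorem eventually_exists_eq_mul_of_involutive [FiniteDimensional ℝ V]
    [LieGroup 𝓘(ℝ, V) ∞ U] {θ : U →* U} (hθ : ContMDiff 𝓘(ℝ, V) 𝓘(ℝ, V) ∞ θ)
    (hinv : Function.Involutive θ) :
    ∀ᶠ g in 𝓝 (1 : U), ∃ k ∈ connectedComponentIn {g : U | θ g = g} 1, ∃ s : U,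
      θ s = s⁻¹ ∧ g = k * s := by
  have : IsTopologicalGroup U := topologicalGroup_of_lieGroup 𝓘(ℝ, V) ∞
  obtain ⟨⟨W, hW, hWinj⟩, hsq⟩ := exists_injOn_sq_and_map_sq_nhds_one (V := V) (U := U)
  have hθc := hθ.continuous
  have hK := eventually_mem_connectedComponentIn_fixedPoints hθ hinv
  have hdiv : Tendsto (fun q : U × U => q.1 * q.2⁻¹) (𝓝 1 ×ˢ 𝓝 1) (𝓝 1) := by
    have : ContinuousAt (fun q : U × U => q.1 * q.2⁻¹) (1, 1) := by fun_prop
    simpa [ContinuousAt, nhds_prod_eq] using this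
  obtain ⟨N, hN, hNK⟩ := eventually_prod_self_iff'.1 (hdiv.eventually hK)
  have hs : ∀ᶠ s in 𝓝 (1 : U), θ s ∈ W ∧ s⁻¹ ∈ W ∧ s ∈ N := by
    have hA : ContinuousAt θ 1 := hθc.continuousAt
    have hB : ContinuousAt (fun s : U => s⁻¹) 1 := by fun_prop
    refine (hA.eventually ?_).and ((hB.eventually ?_).and hN)
    · rw [map_one]; exact hW
    · simpa using hW
  have hroot : ∀ᶠ q in 𝓝 (1 : U), ∃ s, (θ s ∈ W ∧ s⁻¹ ∈ W ∧ s ∈ N) ∧ s * s = q := by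
    rw [← hsq]
    exact image_mem_map hs
  -- If `g = ks`, then `θ(g)⁻¹ g = s²`, so `s` has to be a square root of `θ(g)⁻¹ g`.
  have hτ : ContinuousAt (fun g : U => (θ g)⁻¹ * g) 1 := by fun_prop
  have hroot' := hτ.eventually (by simpa using hroot)
  filter_upwards [hroot', hN] with g hg hgN
  obtain ⟨s, ⟨hs1, hs2, hsN⟩, hsg⟩ := hg
  -- Both sides lie in `W` and have the same square, `g⁻¹ θ(g)`.
  have hθs : θ s = s⁻¹ := by
    apply hWinj hs1 hs2
    change θ s * θ s = s⁻¹ * s⁻¹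
    rw [← map_mul, ← mul_inv_rev, hsg, map_mul, map_inv, hinv g]
    group
  refine ⟨g * s⁻¹, hNK g hgN s hsN ?_, s, hθs, by group⟩
  rw [map_mul, map_inv, hθs, inv_inv, eq_mul_inv_iff_mul_eq, mul_assoc, hsg]
  group

end LieGroupLocal

/-! ### From a neighbourhood of the identity to the whole group. -/

/-- A homomorphism from a connected topological group to a finite-dimensional algebra takes its
values in the linear span of its values on any neighbourhood of the identity. -/
theorem MonoidHom.apply_mem_span_image_of_mem_nhds_one {k A U : Type*} [Field k] [Ring A]
    [Algebra k A] [FiniteDimensional k A] [Group U] [TopologicalSpace U] [IsTopologicalGroup U]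
    [ConnectedSpace U] (f : U →* A) {N : Set U} (hN : N ∈ 𝓝 (1 : U)) (g : U) :
    f g ∈ Submodule.span k (f '' N) := by
  -- A minimal span exists by finite-dimensionality. As neighbourhoods are stable under
  -- intersection, it lies in the span over every other neighbourhood.
  obtain ⟨_, ⟨M, hM, rfl⟩, hmin⟩ := wellFounded_lt.has_min
    ((fun M : Set U => Submodule.span k (f '' M)) '' {M | M ∈ 𝓝 (1 : U)}) ⟨_, _, univ_mem, rfl⟩
  have hle : ∀ M' ∈ 𝓝 (1 : U),
      Submodule.span k (f '' M) ≤ Submodule.span k (f '' M') := by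
    intro M' hM'
    have h1 : Submodule.span k (f '' (M ∩ M')) ≤ Submodule.span k (f '' M) :=
      Submodule.span_mono (Set.image_mono Set.inter_subset_left)
    have h2 := hmin _ ⟨_, inter_mem hM hM', rfl⟩
    rw [← eq_of_le_of_not_lt h1 h2]
    exact Submodule.span_mono (Set.image_mono Set.inter_subset_right)
  -- The span over `M` is also contained in the span over some `M'` with `M' * M' ⊆ M`, so it is
  -- closed under products.
  have hmul : ∀ x ∈ Submodule.span k (f '' M), ∀ y ∈ Submodule.span k (f '' M),
      x * y ∈ Submodule.span k (f '' M) := by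
    have hc : Tendsto (fun q : U × U => q.1 * q.2) (𝓝 1 ×ˢ 𝓝 1) (𝓝 1) := by
      have : ContinuousAt (fun q : U × U => q.1 * q.2) (1, 1) := by fun_prop
      simpa [ContinuousAt, nhds_prod_eq] using this
    obtain ⟨M', hM', hMM⟩ := eventually_prod_self_iff'.1 (hc.eventually_mem hM)
    intro x hx y hy
    have hxy := Submodule.mul_mem_mul (hle M' hM' hx) (hle M' hM' hy)
    rw [Submodule.span_mul_span] at hxy
    refine Submodule.span_mono ?_ hxy
    rintro _ ⟨_, ⟨a, ha, rfl⟩, _, ⟨b, hb, rfl⟩, rfl⟩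
    exact ⟨a * b, hMM a ha b hb, map_mul f a b⟩
  -- An open subgroup, hence all of `U`. The condition on `g⁻¹` is imposed because the span need not
  -- visibly be stable under inversion.
  let H : Subgroup U :=
    { carrier := {g | f g ∈ Submodule.span k (f '' M) ∧ f g⁻¹ ∈ Submodule.span k (f '' M)}
      one_mem' := by
        have : f 1 ∈ Submodule.span k (f '' M) :=
          Submodule.subset_span ⟨1, mem_of_mem_nhds hM, rfl⟩
        exact ⟨this, by simpa using this⟩
      mul_mem' := by
        intro a b ha hb
        refine ⟨?_, ?_⟩
        · rw [map_mul]; exact hmul _ ha.1 _ hb.1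
        · rw [mul_inv_rev, map_mul]; exact hmul _ hb.2 _ ha.2
      inv_mem' := by
        intro a ha
        exact ⟨ha.2, by simpa using ha.1⟩ }
  have hH : (H : Set U) ∈ 𝓝 (1 : U) := by
    have hi : ∀ᶠ x in 𝓝 (1 : U), x⁻¹ ∈ M := by
      have : ContinuousAt (fun x : U => x⁻¹) 1 := by fun_prop
      exact this.eventually (by simpa using hM)
    filter_upwards [hM, hi] with x hx hx'
    exact ⟨Submodule.subset_span ⟨x, hx, rfl⟩, Submodule.subset_span ⟨_, hx', rfl⟩⟩
  have hHo : IsOpen (H : Set U) := H.isOpen_of_mem_nhds hH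
  have hHtop : (H : Set U) = Set.univ :=
    IsClopen.eq_univ ⟨H.isClosed_of_isOpen hHo, hHo⟩ ⟨1, H.one_mem⟩
  have hg : g ∈ (H : Set U) := hHtop ▸ Set.mem_univ g
  exact hle N hN hg.1

/-! ### Cyclic vectors and matrix coefficients. -/

namespace UnitaryIrrep

section

variable {U : Type*} [Group U] [TopologicalSpace U] (π : UnitaryIrrep U) {K : Subgroup U}

theorem mem_fixedVectors {v : π.E} : v ∈ π.fixedVectors K ↔ ∀ k ∈ K, π.ρ k v = v :=
  ⟨fun h k hk => h ⟨k, hk⟩, fun h k => h k k.2⟩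

theorem inner_apply_left (g : U) (v w : π.E) :
    inner ℂ (π.ρ g v) w = inner ℂ v (π.ρ g⁻¹ w) := by
  rw [← π.inner_map_map g⁻¹ (π.ρ g v) w]
  simp

/-- Every nonzero vector of an irreducible representation is cyclic. -/
theorem eq_top_of_forall_apply_mem {v : π.E} (hv : v ≠ 0) (S : Submodule ℂ π.E)
    (hS : ∀ g, π.ρ g v ∈ S) : S = ⊤ := by
  have := π.irreducible
  let W : Subrepresentation π.ρ :=
    { toSubmodule := Submodule.span ℂ (Set.range fun g => π.ρ g v)
      apply_mem_toSubmodule := by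
        intro g w hw
        induction hw using Submodule.span_induction with
        | mem x hx =>
          obtain ⟨h, rfl⟩ := hx
          exact Submodule.subset_span ⟨g * h, by simp⟩
        | zero => simp
        | add x y _ _ hx hy => rw [map_add]; exact add_mem hx hy
        | smul c x _ hx => rw [map_smul]; exact Submodule.smul_mem _ c hx }
  have hvW : v ∈ W.toSubmodule := Submodule.subset_span ⟨1, by simp⟩
  have hW : W = ⊤ := by
    refine (eq_bot_or_eq_top W).resolve_left fun h => hv ?_
    rw [h] at hvW
    exact (Submodule.mem_bot ℂ).1 hvW
  have hW' : W.toSubmodule = ⊤ := by rw [hW]; rfl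
  rw [eq_top_iff, ← hW']
  exact Submodule.span_le.2 (by rintro _ ⟨g, rfl⟩; exact hS g)

theorem integral_linearMap_comp {α : Type*} [MeasurableSpace α] {μ : Measure α}
    (T : π.E →ₗ[ℂ] π.E) {f : α → π.E} (hf : Integrable f μ) :
    ∫ x, T (f x) ∂μ = T (∫ x, f x ∂μ) :=
  have : CompleteSpace π.E := FiniteDimensional.complete ℂ π.E
  (LinearMap.toContinuousLinearMap T).integral_comp_comm hf

/-- The matrix coefficient of two `K`-fixed vectors is invariant under `g ↦ θ(g)⁻¹`. -/
theorem inner_apply_involution_inv {V : Type*} [NormedAddCommGroup V] [NormedSpace ℝ V]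
    [FiniteDimensional ℝ V] [ChartedSpace V U] [LieGroup 𝓘(ℝ, V) ∞ U] [ConnectedSpace U]
    {θ : U →* U} (hK : IsSymmetricPair (V := V) θ K) {v w : π.E}
    (hv : v ∈ π.fixedVectors K) (hw : w ∈ π.fixedVectors K) (g : U) :
    inner ℂ w (π.ρ (θ g)⁻¹ v) = inner ℂ w (π.ρ g v) := by
  have : IsTopologicalGroup U := topologicalGroup_of_lieGroup 𝓘(ℝ, V) ∞
  rw [mem_fixedVectors] at hv hw
  have hloc : ∀ᶠ x in 𝓝 (1 : U), inner ℂ w (π.ρ (θ x)⁻¹ v) = inner ℂ w (π.ρ x v) := by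
    filter_upwards [eventually_exists_eq_mul_of_involutive hK.contMDiff hK.involutive]
      with x ⟨k, hk, s, hs, hx⟩
    have hkK : k ∈ K := hK.identityComponent_subset hk
    have hθk : θ k = k := hK.subset_fixedPoints hkK
    rw [hx, map_mul, hs, hθk, mul_inv_rev, inv_inv, map_mul, map_mul]
    simp only [Module.End.mul_apply]
    rw [hv _ (K.inv_mem hkK)]
    have := π.inner_apply_left k⁻¹ w (π.ρ s v)
    rwa [hw _ (K.inv_mem hkK), inv_inv] at this
  -- `x ↦ π(θ(x)⁻¹)` reverses products, hence the opposite algebra. The desired identity says that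
  -- the linear form `ℓ` vanishes on the values of `f`.
  let f : U →* (Module.End ℂ π.E) × (Module.End ℂ π.E)ᵐᵒᵖ :=
    { toFun := fun x => (π.ρ x, MulOpposite.op (π.ρ (θ x)⁻¹))
      map_one' := by simp
      map_mul' := by intro x y; simp }
  let ℓ : (Module.End ℂ π.E) × (Module.End ℂ π.E)ᵐᵒᵖ →ₗ[ℂ] ℂ :=
    { toFun := fun T => inner ℂ w (T.2.unop v) - inner ℂ w (T.1 v)
      map_add' := by intro S T; simp; ring
      map_smul' := by intro c T; simp; ring }
  have hle : Submodule.span ℂ (f '' _) ≤ LinearMap.ker ℓ :=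
    Submodule.span_le.2 (by
      rintro _ ⟨x, hx, rfl⟩
      exact sub_eq_zero.2 hx)
  exact sub_eq_zero.1 (hle (f.apply_mem_span_image_of_mem_nhds_one hloc g))

end

/-! ### Averages over `K` and Fourier transforms. -/

section

variable {U : Type*} [Group U] [TopologicalSpace U] [CompactSpace U] [MeasurableSpace U]
  [BorelSpace U] (π : UnitaryIrrep U) {K : Subgroup U}

theorem integrable_apply_subgroup (hKc : IsClosed (K : Set U)) (mK : Measure K)
    [IsFiniteMeasure mK] (v : π.E) : Integrable (fun k : K => π.ρ k v) mK := by
  have : CompactSpace K := isCompact_iff_compactSpace.1 hKc.isCompact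
  have hc : Continuous fun k : K => π.ρ k v := (π.continuous_apply v).comp continuous_subtype_val
  have : ProperSpace π.E := FiniteDimensional.proper ℂ π.E
  exact hc.integrable_of_hasCompactSupport (HasCompactSupport.of_compactSpace _)

variable [IsTopologicalGroup U]

theorem integrable_apply_inv_subgroup (hKc : IsClosed (K : Set U)) (mK : Measure K)
    [IsFiniteMeasure mK] (v : π.E) : Integrable (fun k : K => π.ρ (k : U)⁻¹ v) mK := by
  have : CompactSpace K := isCompact_iff_compactSpace.1 hKc.isCompact
  have hc : Continuous fun k : K => π.ρ (k : U)⁻¹ v :=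
    (π.continuous_apply v).comp continuous_subtype_val.inv
  have : ProperSpace π.E := FiniteDimensional.proper ℂ π.E
  exact hc.integrable_of_hasCompactSupport (HasCompactSupport.of_compactSpace _)

/-- Averaging over `K` is the orthogonal projection onto the `K`-fixed vectors. -/
theorem integral_apply_subgroup (hKc : IsClosed (K : Set U)) (mK : Measure K)
    [mK.IsHaarMeasure] [IsProbabilityMeasure mK] (v : π.E) :
    ∫ k : K, π.ρ k v ∂mK = (π.fixedVectors K).starProjection v := by
  have : CompleteSpace π.E := FiniteDimensional.complete ℂ π.E
  symm
  have hInt := π.integrable_apply_subgroup hKc mK v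
  refine Submodule.eq_starProjection_of_mem_of_inner_eq_zero ?_ ?_
  · rw [mem_fixedVectors]
    intro k hk
    rw [← π.integral_linearMap_comp _ hInt]
    have := integral_mul_left_eq_self (μ := mK) (fun x : K => π.ρ x v) ⟨k, hk⟩
    simpa using this
  · intro w hw
    rw [inner_sub_left, sub_eq_zero, ← inner_conj_symm v w,
      ← inner_conj_symm (∫ k : K, π.ρ k v ∂mK) w, ← integral_inner hInt]
    congr 1
    have : ∀ k : K, inner ℂ w (π.ρ k v) = inner ℂ w v := by
      intro k
      conv_lhs => rw [← (π.mem_fixedVectors.1 hw) k k.2]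
      exact π.inner_map_map _ _ _
    simp [this]

/-- By unitarity this average is the adjoint of the one over `π(k)`, and an orthogonal projection is
self-adjoint. -/
theorem integral_apply_inv_subgroup (hKc : IsClosed (K : Set U)) (mK : Measure K)
    [mK.IsHaarMeasure] [IsProbabilityMeasure mK] (v : π.E) :
    ∫ k : K, π.ρ (k : U)⁻¹ v ∂mK = (π.fixedVectors K).starProjection v := by
  have : CompleteSpace π.E := FiniteDimensional.complete ℂ π.E
  refine ext_inner_left ℂ fun w => ?_
  rw [← integral_inner (π.integrable_apply_inv_subgroup hKc mK v),
    ← Submodule.inner_starProjection_left_eq_right, ← π.integral_apply_subgroup hKc mK w,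
    ← inner_conj_symm (∫ k : K, π.ρ k w ∂mK) v,
    ← integral_inner (π.integrable_apply_subgroup hKc mK w), ← integral_conj]
  congr 1
  ext k
  rw [inner_conj_symm, π.inner_apply_left]

theorem fourier_apply (μ : Measure U) [IsFiniteMeasure μ] (v : π.E) :
    π.fourier μ v = ∫ g, π.ρ g⁻¹ v ∂μ := rfl

/-- The Fourier transform reverses convolution. -/
theorem fourier_mconv [SecondCountableTopology U] (μ ν : Measure U) [IsFiniteMeasure μ]
    [IsFiniteMeasure ν] [IsFiniteMeasure (Measure.mconv μ ν)] :
    π.fourier (Measure.mconv μ ν) = π.fourier ν * π.fourier μ := by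
  ext v
  rw [Module.End.mul_apply, fourier_apply,
    integral_mconv (π.integrable_apply_inv (Measure.mconv μ ν) v), fourier_apply π μ,
    ← π.integral_linearMap_comp _ (π.integrable_apply_inv μ v)]
  simp [fourier_apply]

theorem fourier_dirac_one : π.fourier (Measure.dirac 1) = 1 := by
  ext v
  have : ProperSpace π.E := FiniteDimensional.proper ℂ π.E
  have hc : Continuous fun g : U => π.ρ g⁻¹ v := (π.continuous_apply v).comp continuous_inv
  rw [fourier_apply, integral_dirac' _ _ hc.stronglyMeasurable]
  simp

theorem fourier_convPow [SecondCountableTopology U] (μ : Measure U) [IsFiniteMeasure μ] (p : ℕ) :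
    π.fourier (convPow μ p) = π.fourier μ ^ p := by
  induction p with
  | zero => exact π.fourier_dirac_one
  | succ p ih =>
    have : IsFiniteMeasure (Measure.mconv (convPow μ p) μ) :=
      inferInstanceAs (IsFiniteMeasure (convPow μ (p + 1)))
    rw [pow_succ', ← ih]
    exact π.fourier_mconv (convPow μ p) μ

/-- In `(k₁ a k₂)⁻¹ = k₂⁻¹ a⁻¹ k₁⁻¹` each outer factor integrates to the projection, by Fubini. -/
theorem fourier_orbitalMeasure [SecondCountableTopology U] (hKc : IsClosed (K : Set U))
    (mK : Measure K) [mK.IsHaarMeasure] [IsProbabilityMeasure mK] (a : U) (v : π.E) :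
    π.fourier (orbitalMeasure mK a) v =
      (π.fixedVectors K).starProjection (π.ρ a⁻¹ ((π.fixedVectors K).starProjection v)) := by
  have : CompactSpace K := isCompact_iff_compactSpace.1 hKc.isCompact
  have : ProperSpace π.E := FiniteDimensional.proper ℂ π.E
  have : BorelSpace K := Subtype.borelSpace _
  have : SecondCountableTopology K := TopologicalSpace.Subtype.secondCountableTopology _
  have hcont : Continuous fun k : K × K => (k.1 : U) * a * (k.2 : U) := by fun_prop
  have hρ : Continuous fun g : U => π.ρ g⁻¹ v := (π.continuous_apply v).comp continuous_inv
  have hInt : Integrable (fun k : K × K => π.ρ ((k.1 : U) * a * (k.2 : U))⁻¹ v) (mK.prod mK) :=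
    (hρ.comp hcont).integrable_of_hasCompactSupport (HasCompactSupport.of_compactSpace _)
  rw [fourier_apply, orbitalMeasure, integral_map hcont.measurable.aemeasurable
    hρ.aestronglyMeasurable, integral_prod _ hInt]
  have h1 : ∀ k₁ : K, ∫ k₂ : K, π.ρ ((k₁ : U) * a * (k₂ : U))⁻¹ v ∂mK =
      ((π.fixedVectors K).starProjection.toLinearMap ∘ₗ π.ρ a⁻¹) (π.ρ (k₁ : U)⁻¹ v) := by
    intro k₁
    simp only [mul_inv_rev, map_mul, Module.End.mul_apply]
    exact π.integral_apply_inv_subgroup hKc mK _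
  simp only [h1]
  rw [π.integral_linearMap_comp _ (π.integrable_apply_inv_subgroup hKc mK v),
    π.integral_apply_inv_subgroup hKc mK v]
  rfl

end

end UnitaryIrrep

/-! ### The Gelfand property of symmetric pairs. -/

namespace UnitaryIrrep

section

variable {V : Type*} [NormedAddCommGroup V] [NormedSpace ℝ V] [FiniteDimensional ℝ V]
  {U : Type*} [Group U] [TopologicalSpace U] [ChartedSpace V U] [LieGroup 𝓘(ℝ, V) ∞ U]
  [ConnectedSpace U] (π : UnitaryIrrep U) {K : Subgroup U} {θ : U →* U}

theorem starProjection_apply_involution_inv (hK : IsSymmetricPair (V := V) θ K) {v : π.E}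
    (hv : v ∈ π.fixedVectors K) (g : U) :
    (π.fixedVectors K).starProjection (π.ρ (θ g)⁻¹ v) =
      (π.fixedVectors K).starProjection (π.ρ g v) := by
  refine ext_inner_left ℂ fun w => ?_
  rw [← Submodule.inner_starProjection_left_eq_right,
    ← Submodule.inner_starProjection_left_eq_right]
  exact π.inner_apply_involution_inv hK hv (Submodule.starProjection_apply_mem _ _) g

variable [IsTopologicalGroup U] [CompactSpace U] [MeasurableSpace U] [BorelSpace U]

/-- The operators `P π(g) P`, where `P` is the orthogonal projection onto the `K`-fixed vectors of
a symmetric pair, commute. -/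
theorem starProjection_apply_comm (hK : IsSymmetricPair (V := V) θ K) (mK : Measure K)
    [mK.IsHaarMeasure] [IsProbabilityMeasure mK] {v : π.E} (hv : v ∈ π.fixedVectors K) (g h : U) :
    (π.fixedVectors K).starProjection (π.ρ g ((π.fixedVectors K).starProjection (π.ρ h v))) =
      (π.fixedVectors K).starProjection
        (π.ρ h ((π.fixedVectors K).starProjection (π.ρ g v))) := by
  set P := (π.fixedVectors K).starProjection with hP
  have h1 : P (π.ρ g (P (π.ρ h v))) = ∫ k : K, P (π.ρ g (π.ρ k (π.ρ h v))) ∂mK := by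
    rw [hP, ← π.integral_apply_subgroup hK.isClosed mK (π.ρ h v)]
    exact (π.integral_linearMap_comp (P.toLinearMap ∘ₗ π.ρ g)
      (π.integrable_apply_subgroup hK.isClosed mK _)).symm
  have h2 : P (π.ρ (θ h)⁻¹ (P (π.ρ (θ g)⁻¹ v))) =
      ∫ k : K, P (π.ρ (θ h)⁻¹ (π.ρ (k : U)⁻¹ (π.ρ (θ g)⁻¹ v))) ∂mK := by
    rw [hP, ← π.integral_apply_inv_subgroup hK.isClosed mK (π.ρ (θ g)⁻¹ v)]
    exact (π.integral_linearMap_comp (P.toLinearMap ∘ₗ π.ρ (θ h)⁻¹)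
      (π.integrable_apply_inv_subgroup hK.isClosed mK _)).symm
  -- Apply the invariance to `g k h`: the anti-automorphism reverses the factors and inverts `k`,
  -- which `θ` fixes.
  have h3 : ∀ k : K, P (π.ρ g (π.ρ k (π.ρ h v))) =
      P (π.ρ (θ h)⁻¹ (π.ρ (k : U)⁻¹ (π.ρ (θ g)⁻¹ v))) := by
    intro k
    have hk : θ k = k := hK.subset_fixedPoints k.2
    have := π.starProjection_apply_involution_inv hK hv (g * k * h)
    simp only [map_mul, mul_inv_rev, hk, Module.End.mul_apply] at this
    exact this.symm
  rw [h1]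
  simp only [h3]
  rw [← h2, hP, π.starProjection_apply_involution_inv hK (Submodule.starProjection_apply_mem _ _),
    π.starProjection_apply_involution_inv hK hv]

/-- Symmetric pairs are Gelfand pairs: the `K`-fixed vectors of an irreducible representation form
a space of dimension at most one. -/
theorem finrank_fixedVectors_le_one (hK : IsSymmetricPair (V := V) θ K) (mK : Measure K)
    [mK.IsHaarMeasure] [IsProbabilityMeasure mK] : finrank ℂ (π.fixedVectors K) ≤ 1 := by
  rcases subsingleton_or_nontrivial (π.fixedVectors K) with hs | hn
  · simp [finrank_zero_of_subsingleton]
  set P := (π.fixedVectors K).starProjection with hP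
  have hPfix : ∀ u ∈ π.fixedVectors K, P u = u := fun u hu =>
    Submodule.starProjection_eq_self_iff.2 hu
  have hscalar : ∀ h : U, ∃ c : ℂ, ∀ u ∈ π.fixedVectors K, P (π.ρ h u) = c • u := by
    intro h
    let T : Module.End ℂ (π.fixedVectors K) :=
      ((P.toLinearMap ∘ₗ π.ρ h) ∘ₗ (π.fixedVectors K).subtype).codRestrict (π.fixedVectors K)
        fun u => Submodule.starProjection_apply_mem _ _
    obtain ⟨c, hc⟩ := Module.End.exists_eigenvalue T
    obtain ⟨v, hv⟩ := hc.exists_hasEigenvector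
    have hTv : P (π.ρ h v) = c • (v : π.E) := congrArg Subtype.val hv.apply_eq_smul
    have hv0 : (v : π.E) ≠ 0 := fun h0 => hv.2 (Subtype.ext h0)
    -- Schur's argument: commutativity puts the whole orbit of the eigenvector `v` into `S`, and `v`
    -- is cyclic. So `P π(h) P = c P`.
    let S : Submodule ℂ π.E :=
      LinearMap.ker (P.toLinearMap ∘ₗ π.ρ h ∘ₗ P.toLinearMap - c • P.toLinearMap)
    have hS : S = ⊤ := by
      refine π.eq_top_of_forall_apply_mem hv0 S fun g => ?_
      have := π.starProjection_apply_comm hK mK v.2 h g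
      rw [← hP, hTv] at this
      simp [S, LinearMap.mem_ker, this]
    refine ⟨c, fun u hu => ?_⟩
    have hu' : u ∈ S := hS ▸ Submodule.mem_top
    have := sub_eq_zero.1 (LinearMap.mem_ker.1 hu')
    simpa [hPfix u hu] using this
  obtain ⟨v, hv⟩ := exists_ne (0 : π.fixedVectors K)
  have hv0 : (v : π.E) ≠ 0 := fun h0 => hv (Subtype.ext h0)
  -- As `P π(g) v` is always a multiple of `v`, cyclicity gives `P E ⊆ ℂv`.
  have hS := π.eq_top_of_forall_apply_mem hv0
    ((Submodule.span ℂ {(v : π.E)}).comap P.toLinearMap) fun g => by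
      obtain ⟨c, hc⟩ := hscalar g
      exact Submodule.mem_span_singleton.2 ⟨c, (hc v v.2).symm⟩
  refine finrank_le_one v fun w => ?_
  have hw : (w : π.E) ∈ (Submodule.span ℂ {(v : π.E)}).comap P.toLinearMap :=
    hS ▸ Submodule.mem_top
  obtain ⟨c, hc⟩ := Submodule.mem_span_singleton.1 hw
  exact ⟨c, Subtype.ext (hc.trans (hPfix w w.2))⟩

end

/-! ### Hilbert–Schmidt norms in the spherical and non-spherical cases. -/

section

variable {U : Type*} [Group U] [TopologicalSpace U] (π : UnitaryIrrep U) {K : Subgroup U}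

theorem starProjection_fixedVectors_apply {X : π.E} (hπ : π.IsSpherical K)
    (hX : X ∈ π.fixedVectors K) (hX1 : ‖X‖ = 1) (v : π.E) :
    (π.fixedVectors K).starProjection v = inner ℂ X v • X := by
  have hspan : π.fixedVectors K = Submodule.span ℂ {X} := by
    symm
    refine Submodule.eq_of_le_of_finrank_eq ((Submodule.span_singleton_le_iff_mem _ _).2 hX) ?_
    rw [hπ, finrank_span_singleton (by rintro rfl; simp at hX1)]
  simp only [hspan]
  exact Submodule.starProjection_unit_singleton ℂ hX1 v

variable [IsTopologicalGroup U] [CompactSpace U] [MeasurableSpace U] [BorelSpace U]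

/-- Since `⟨X, X⟩ = 1`, powers of `c ⟨X, ·⟩ X` only raise `c` to a power. The exponent `0` is
excluded, as it gives the identity operator. -/
theorem fourier_convPow_orbitalMeasure_apply [SecondCountableTopology U]
    (hKc : IsClosed (K : Set U)) (mK : Measure K) [mK.IsHaarMeasure] [IsProbabilityMeasure mK]
    {X : π.E} (hπ : π.IsSpherical K) (hX : X ∈ π.fixedVectors K) (hX1 : ‖X‖ = 1) (a : U)
    {p : ℕ} (hp : p ≠ 0) (v : π.E) :
    π.fourier (convPow (orbitalMeasure mK a) p) v =
      ((inner ℂ X (π.ρ a⁻¹ X)) ^ p * inner ℂ X v) • X := by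
  have hXX : inner ℂ X X = (1 : ℂ) := by simp [inner_self_eq_norm_sq_to_K, hX1]
  have hone : ∀ w, π.fourier (orbitalMeasure mK a) w =
      (inner ℂ X (π.ρ a⁻¹ X) * inner ℂ X w) • X := by
    intro w
    rw [π.fourier_orbitalMeasure hKc mK, π.starProjection_fixedVectors_apply hπ hX hX1 w,
      π.starProjection_fixedVectors_apply hπ hX hX1]
    simp [mul_comm]
  rw [fourier_convPow]
  induction p, Nat.one_le_iff_ne_zero.2 hp using Nat.le_induction with
  | base => simp [hone]
  | succ p hp' ih =>
    rw [pow_succ', Module.End.mul_apply, ih (by lia), hone, inner_smul_right, hXX]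
    congr 1
    ring

theorem hsNormSq_fourier_convPow_orbitalMeasure [SecondCountableTopology U]
    (hKc : IsClosed (K : Set U)) (mK : Measure K) [mK.IsHaarMeasure] [IsProbabilityMeasure mK]
    {X : π.E} (hπ : π.IsSpherical K) (hX : X ∈ π.fixedVectors K) (hX1 : ‖X‖ = 1) (a : U)
    {p : ℕ} (hp : p ≠ 0) :
    π.hsNormSq (π.fourier (convPow (orbitalMeasure mK a) p)) =
      ‖inner ℂ X (π.ρ a X)‖ ^ (2 * p) := by
  have hnorm : ‖inner ℂ X (π.ρ a⁻¹ X)‖ = ‖inner ℂ X (π.ρ a X)‖ := by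
    rw [← π.inner_apply_left, norm_inner_symm]
  simp only [hsNormSq, π.fourier_convPow_orbitalMeasure_apply hKc mK hπ hX hX1 a hp, norm_smul,
    norm_mul, norm_pow, hX1, mul_one, hnorm, mul_pow]
  rw [← Finset.mul_sum]
  -- Parseval: the factors `⟨X, e_i⟩` contribute `‖X‖² = 1`.
  have hsum := (stdOrthonormalBasis ℂ π.E).sum_sq_norm_inner_left X
  rw [hX1, one_pow] at hsum
  rw [hsum, mul_one, ← pow_mul, mul_comm p 2]

theorem hsNormSq_fourier_convPow_orbitalMeasure_eq_zero [SecondCountableTopology U]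
    (hKc : IsClosed (K : Set U)) (mK : Measure K) [mK.IsHaarMeasure] [IsProbabilityMeasure mK]
    (hπ : π.fixedVectors K = ⊥) (a : U) {p : ℕ} (hp : p ≠ 0) :
    π.hsNormSq (π.fourier (convPow (orbitalMeasure mK a) p)) = 0 := by
  have h0 : π.fourier (orbitalMeasure mK a) = 0 := by
    ext v
    rw [π.fourier_orbitalMeasure hKc mK]
    simp [hπ]
  rw [fourier_convPow, h0, zero_pow hp]
  simp [hsNormSq]

end

end UnitaryIrrep

/-! ### The Plancherel sum, compared class by class. -/

theorem proposition2
    {V : Type*} [NormedAddCommGroup V] [NormedSpace ℝ V] [FiniteDimensional ℝ V]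
    {U : Type*} [Group U] [TopologicalSpace U] [T2Space U] [ChartedSpace V U]
    [LieGroup 𝓘(ℝ, V) ∞ U] [IsTopologicalGroup U] [CompactSpace U] [ConnectedSpace U]
    [MeasurableSpace U] [BorelSpace U]
    (θ : U →* U) (K : Subgroup U) (hK : IsSymmetricPair (V := V) θ K)
    (mK : Measure K) [mK.IsHaarMeasure] [IsProbabilityMeasure mK]
    (r : UnitaryDual U → UnitaryIrrep U) (hr : ∀ c, Quotient.mk _ (r c) = c)
    (X : ∀ c : UnitaryDual U, (r c).E)
    (hX : ∀ c, (r c).IsSpherical K → X c ∈ (r c).fixedVectors K ∧ ‖X c‖ = 1)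
    (a : U) (p : ℕ) (hp : 2 ≤ p) :
    plancherelNormSq r (convPow (orbitalMeasure mK a) p) =
      ∑' c : {c : UnitaryDual U // (r c).IsSpherical K},
        (finrank ℂ (r c).E : ℝ≥0∞) *
          ENNReal.ofReal (‖inner ℂ (X c) ((r c).ρ a (X c))‖ ^ (2 * p)) := by
  have : ProperSpace V := FiniteDimensional.proper ℝ V
  have : SecondCountableTopology U := ChartedSpace.secondCountable_of_sigmaCompact V U
  have hp0 : p ≠ 0 := by lia
  -- The sum over spherical classes becomes a sum over the whole dual with an indicator, so that
  -- terms can be compared singly.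
  refine Eq.trans ?_ (tsum_subtype {c : UnitaryDual U | (r c).IsSpherical K}
    fun c => (finrank ℂ (r c).E : ℝ≥0∞) *
      ENNReal.ofReal (‖inner ℂ (X c) ((r c).ρ a (X c))‖ ^ (2 * p))).symm
  refine tsum_congr fun c => ?_
  by_cases hc : (r c).IsSpherical K
  · rw [Set.indicator_of_mem (show c ∈ {c : UnitaryDual U | (r c).IsSpherical K} from hc),
      (r c).hsNormSq_fourier_convPow_orbitalMeasure hK.isClosed mK hc (hX c hc).1 (hX c hc).2 a hp0]
  · rw [Set.indicator_of_notMem (show c ∉ {c : UnitaryDual U | (r c).IsSpherical K} from hc)]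
    -- By the Gelfand property, non-spherical means that there are no nonzero `K`-fixed vectors.
    have hbot : (r c).fixedVectors K = ⊥ := by
      have hle := (r c).finrank_fixedVectors_le_one hK mK
      have hne : finrank ℂ ((r c).fixedVectors K) ≠ 1 := hc
      exact Submodule.finrank_eq_zero.1 (by lia)
    rw [(r c).hsNormSq_fourier_convPow_orbitalMeasure_eq_zero hK.isClosed mK hbot a hp0]
    simp
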